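/- \textbf{Setting.} Let $N$ be a finite set of agents and $D=\{0,1\}$. A ballot of agent $a$ is an ordered list $B_a = B_a(0)\succ\dots\succ B_a(k_a-1)\succ\tau_a$, where $k_a \ge 0$, the entries $B_a(0),\dots,B_a(k_a-1)$ are pairwise distinct agents in $N\setminus\{a\}$, and $\tau_a\in D$; put $B_a(k_a)=\tau_a$. A direct vote for $d$ is the ballot with $k_a=0$ and $\tau_a=d$. The delegation graph of a ballot list $\vec B=(B_a)_{a\in N}$ has vertex set $N\cup D\cup\{r\}$ and edges $d\to r$ for $d\in D$ and $a\to B_a(i)$ for $a\in N$, $0\le i\le k_a$. A certificate $\vec c=(c_a)_{a\in N}$ with $0\le c_a\le k_a$ is consistent if $T_{\vec c}=\{(a,B_a(c_a)) : a\in N\}\cup\{(d,r) : d\in D\}$ is an arborescence (a directed spanning tree with sink $r$) of the delegation graph; it then induces the concrete votes $\vec X\in D^N$, where $X_a$ is the alternative on the path from $a$ to $r$ in $T_{\vec c}$. Let $\mathrm{MinSum}(\vec B)\subseteq D^N$ be the set of concrete votes induced by the consistent certificates that minimise $\sum_{a\in N}c_a$ among all consistent certificates. For $p\in\{0,1\}$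 let $\mathrm{MinSum}^p(\vec B)$ be the set of those $\vec X\in\mathrm{MinSum}(\vec B)$ for which $|\{a\in N : X_a=p\}|$ is largest. An unravelling procedure $F$ maps each ballot list to a set of concrete votes $F(\vec B)\subseteq D^N$. It is resolute if $F(\vec B)$ is always a singleton. It is cast-monotonic if for every aggregation function $\mathit{agg}:\{0,1\}^N\to\{0,1\}$ that is monotone for the coordinatewise order, every ballot list $\vec B$, every agent $a\in N$ and every $d\in D$, writing $\vec B'$ for $\vec B$ with $B_a$ replaced by a direct vote for $d$ and $\mathit{agg}(F(\vec B))=\{\mathit{agg}(\vec X) : \vec X\in F(\vec B)\}$: (i) $d\in \mathit{agg}(F(\vec B))$ implies $d\in \mathit{agg}(F(\vec B'))$; and (ii) $1-d\notin \mathit{agg}(F(\vec B))$ implies $1-d\notin \mathit{agg}(F(\vec B'))$. \textbf{Theorem.} $\mathrm{MinSum}$, $\mathrm{MinSum}^0$ and $\mathrm{MinSum}^1$ are cast-monotonic, and $\mathrm{MinSum}^0$ and $\mathrm{MinSum}^1$ are resolute. -/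

import Mathlib

namespace LiquidDemocracy

/-- The vertices of the delegation graph: the agents, the alternatives and the root `r`. -/
inductive Vertex (N D : Type*) where
  | agent (a : N) : Vertex N D
  | alt (d : D) : Vertex N D
  | root : Vertex N D

/-- An ordered ballot `B_a(0) ≻ … ≻ B_a(k_a - 1) ≻ τ_a` of agent `a`: a list of pairwise distinct
agents other than `a`, followed by a direct vote `τ_a` for an alternative. -/
structure Ballot (N D : Type*) (a : N) where
  delegates : List N
  nodup : delegates.Nodup
  self_notMem : a ∉ delegates
  backup : D

namespace Ballot

variable {N D : Type*} {a : N}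

/-- The size `k_a` of the ballot, i.e. the number of its delegations. -/
def size (b : Ballot N D a) : ℕ := b.delegates.length

/-- The entry `B_a(i)` for `0 ≤ i ≤ k_a`, with `B_a(k_a) = τ_a`. -/
def entry (b : Ballot N D a) (i : Fin (b.size + 1)) : Vertex N D :=
  if h : (i : ℕ) < b.delegates.length then Vertex.agent (b.delegates[(i : ℕ)]'h)
  else Vertex.alt b.backup

/-- The ballot of size `0` by which agent `a` votes directly for `d`. -/
def direct (a : N) (d : D) : Ballot N D a where
  delegates := []
  nodup := List.nodup_nil
  self_notMem := List.not_mem_nil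
  backup := d

end Ballot

/-- A ballot list `(B_a)_{a ∈ N}`. -/
abbrev BallotList (N D : Type*) := (a : N) → Ballot N D a

/-- The edges of the delegation graph: `a → B_a(i)` for `0 ≤ i ≤ k_a`, and `d → r`. -/
inductive DelegationEdge {N D : Type*} (B : BallotList N D) : Vertex N D → Vertex N D → Prop
  | entry (a : N) (i : Fin ((B a).size + 1)) :
      DelegationEdge B (Vertex.agent a) ((B a).entry i)
  | alt (d : D) : DelegationEdge B (Vertex.alt d) Vertex.root

/-- `T` is the edge set of an `r`-arborescence of the directed graph with edge set `E`, that is, of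
a directed spanning tree with sink `r`. -/
structure IsArborescence {V : Type*} (E : V → V → Prop) (r : V) (T : V → V → Prop) : Prop where
  subgraph : ∀ u v, T u v → E u v
  root_sink : ∀ v, ¬ T r v
  existsUnique_out : ∀ u, u ≠ r → ∃! v, T u v
  reaches_root : ∀ u, Relation.ReflTransGen T u r

/-- A certificate: a position `0 ≤ c_a ≤ k_a` for every agent `a`. -/
abbrev Certificate {N D : Type*} (B : BallotList N D) := (a : N) → Fin ((B a).size + 1)

/-- The edge set `T_c = {(a, B_a(c_a)) | a ∈ N} ∪ {(d, r) | d ∈ D}`. -/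
inductive CertificateEdge {N D : Type*} (B : BallotList N D) (c : Certificate B) :
    Vertex N D → Vertex N D → Prop
  | chosen (a : N) : CertificateEdge B c (Vertex.agent a) ((B a).entry (c a))
  | alt (d : D) : CertificateEdge B c (Vertex.alt d) Vertex.root

/-- A certificate `c` is consistent if `T_c` is an `r`-arborescence of the delegation graph. -/
def IsConsistent {N D : Type*} (B : BallotList N D) (c : Certificate B) : Prop :=
  IsArborescence (DelegationEdge B) Vertex.root (CertificateEdge B c)

/-- The certificate `c` induces the concrete votes `X`: for every agent `a`, the alternative `X_a`
lies on the path in `T_c` that starts at `a`. -/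
def Induces {N D : Type*} (B : BallotList N D) (c : Certificate B) (X : N → D) : Prop :=
  ∀ a, Relation.ReflTransGen (CertificateEdge B c) (Vertex.agent a) (Vertex.alt (X a))

/-- A consistent certificate that minimises `∑_a c_a` among all consistent certificates. -/
def IsMinSumCertificate {N D : Type*} [Fintype N] (B : BallotList N D) (c : Certificate B) : Prop :=
  IsConsistent B c ∧
    ∀ c' : Certificate B, IsConsistent B c' → ∑ a, (c a : ℕ) ≤ ∑ a, (c' a : ℕ)

/-- A (possibly irresolute) unravelling procedure `F`; `F B` is the set of the collections of
concrete votes that it can output on input `B`. -/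
abbrev UnravellingProcedure (N D : Type*) := BallotList N D → Set (N → D)

/-- The irresolute procedure MinSum. -/
def minSum {N D : Type*} [Fintype N] : UnravellingProcedure N D := fun B =>
  {X | ∃ c : Certificate B, IsMinSumCertificate B c ∧ Induces B c X}

/-- The biased variant MinSum^p: among the outputs of MinSum, those with the highest possible number
of votes for `p`. -/
def minSumBiased {N D : Type*} [Fintype N] [DecidableEq D] (p : D) : UnravellingProcedure N D :=
  fun B =>
    {X | X ∈ minSum B ∧ ∀ Y ∈ minSum B,
      (Finset.univ.filter fun a => Y a = p).card ≤ (Finset.univ.filter fun a => X a = p).card}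

/-- `F` is resolute if it has exactly one output on every ballot list. -/
def IsResolute {N D : Type*} (F : UnravellingProcedure N D) : Prop :=
  ∀ B : BallotList N D, ∃! X : N → D, X ∈ F B

/-- The set `agg(F(B))` of the possible winning alternatives. -/
def winners {N D : Type*} (agg : (N → D) → D) (F : UnravellingProcedure N D)
    (B : BallotList N D) : Set D :=
  agg '' F B

/-- Cast monotonicity with respect to `agg`, for the alternatives `0 = false` and `1 = true`, so
that `!d` is `1 - d`. -/
def CastMonotonicWrt {N : Type*} [DecidableEq N] (F : UnravellingProcedure N Bool)
    (agg : (N → Bool) → Bool) : Prop :=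
  ∀ (B : BallotList N Bool) (a : N) (d : Bool),
    (d ∈ winners agg F B → d ∈ winners agg F (Function.update B a (Ballot.direct a d))) ∧
    ((!d) ∉ winners agg F B → (!d) ∉ winners agg F (Function.update B a (Ballot.direct a d)))

/-- (Unconditional) cast monotonicity: cast monotonicity with respect to every monotonic
aggregation function. -/
def CastMonotonic {N : Type*} [DecidableEq N] (F : UnravellingProcedure N Bool) : Prop :=
  ∀ agg : (N → Bool) → Bool, Monotone agg → CastMonotonicWrt F agg

end LiquidDemocracy

namespace LiquidDemocracy

variable {N D : Type*}

/-! Everything rests on an uncrossing argument. Take optimal certificates of two ballot lists, with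
votes `X` and `X'`, such that the ballots differ only at agents with `X' a = d`. Swapping the two
certificates on that set yields one certificate for each list: one whose `d`-voters include the
union of the two sets of `d`-voters, one whose `d`-voters lie in the intersection. Both are
consistent and their total cost is unchanged, so both are optimal (`minSum_exchange`).

For equal lists, the sets of `p`-voters are thus directed under inclusion, so a largest one contains
all others (`eq_of_mem_minSumBiased`) and the biased rules are resolute. When `a` switches to a
direct vote for `d`, the only changed ballot belongs to a `d`-voter; the union and the intersection
then give the two halves of cast monotonicity. -/

/-- Following the successor function `f` from agent `a` leads to the alternative `d`. -/
inductive Votes (f : N → Vertex N D) (d : D) : N → Prop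
  | direct {a : N} (h : f a = Vertex.alt d) : Votes f d a
  | delegate {a b : N} (h : f a = Vertex.agent b) (hb : Votes f d b) : Votes f d a

theorem Votes.unique {f : N → Vertex N D} {d e : D} {a : N} (hd : Votes f d a)
    (he : Votes f e a) : d = e := by
  induction hd with
  | direct h =>
    cases he with
    | direct h' => simpa [h] using h'
    | delegate h' _ => simp [h] at h'
  | delegate h _ ih =>
    cases he with
    | direct h' => simp [h] at h'
    | delegate h' hb' =>
      rw [h] at h'
      cases h'
      exact ih hb'

/-- The vertex to which `c` lets an agent delegate. -/
def successor (B : BallotList N D) (c : Certificate B) (a : N) : Vertex N D :=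
  (B a).entry (c a)

theorem Ballot.entry_eq_agent_or_alt {a : N} (b : Ballot N D a) (i : Fin (b.size + 1)) :
    (∃ x, b.entry i = Vertex.agent x) ∨ ∃ d, b.entry i = Vertex.alt d := by
  unfold Ballot.entry
  split <;> simp

theorem Ballot.entry_congr {a : N} {b b' : Ballot N D a} (h : b = b') {i : Fin (b.size + 1)}
    {j : Fin (b'.size + 1)} (hij : (i : ℕ) = j) : b.entry i = b'.entry j := by
  subst h
  rw [Fin.ext hij]

theorem votes_iff_reflTransGen {B : BallotList N D} {c : Certificate B} {d : D} {a : N} :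
    Votes (successor B c) d a ↔
      Relation.ReflTransGen (CertificateEdge B c) (Vertex.agent a) (Vertex.alt d) := by
  constructor
  · intro h
    induction h with
    | @direct a h =>
      rw [← h]
      exact .single (.chosen a)
    | @delegate a b h _ ih =>
      rw [← h] at ih
      exact .head (.chosen a) ih
  · suffices H : ∀ v, Relation.ReflTransGen (CertificateEdge B c) v (Vertex.alt d) →
        ∀ a, v = Vertex.agent a → Votes (successor B c) d a from fun h => H _ h a rfl
    intro v h
    induction h using Relation.ReflTransGen.head_induction_on with
    | refl => intro a ha; cases ha
    | head huv hv ih =>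
      rintro a rfl
      cases huv
      rcases (B a).entry_eq_agent_or_alt (c a) with ⟨b, hb⟩ | ⟨e, he⟩
      · exact .delegate hb (ih b hb)
      · rw [he] at hv
        -- From an alternative only itself and the root are reachable, and the root is a sink.
        rcases Relation.ReflTransGen.cases_head hv with h | ⟨w, hw, hwd⟩
        · exact .direct (he.trans h)
        · cases hw
          rcases Relation.ReflTransGen.cases_head hwd with h | ⟨w, hw, _⟩
          · cases h
          · cases hw

theorem induces_iff_votes {B : BallotList N D} {c : Certificate B} {X : N → D} :
    Induces B c X ↔ ∀ a, Votes (successor B c) (X a) a :=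
  forall_congr' fun _ => votes_iff_reflTransGen.symm

theorem IsConsistent.exists_induces {B : BallotList N D} {c : Certificate B}
    (h : IsConsistent B c) : ∃ X, Induces B c X := by
  suffices H : ∀ v, Relation.ReflTransGen (CertificateEdge B c) v Vertex.root →
      ∀ a, v = Vertex.agent a → ∃ d, Votes (successor B c) d a by
    choose X hX using fun a => H _ (h.reaches_root (Vertex.agent a)) a rfl
    exact ⟨X, induces_iff_votes.2 hX⟩
  intro v hv
  induction hv using Relation.ReflTransGen.head_induction_on with
  | refl => intro a ha; cases ha
  | head huv _ ih =>
    rintro a rfl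
    cases huv
    rcases (B a).entry_eq_agent_or_alt (c a) with ⟨b, hb⟩ | ⟨e, he⟩
    · obtain ⟨d, hd⟩ := ih b hb
      exact ⟨d, .delegate hb hd⟩
    · exact ⟨e, .direct he⟩

/-- The only arborescence condition that can fail for a certificate is reaching the root, so
exhibiting a vote for every agent suffices. -/
theorem Induces.isConsistent {B : BallotList N D} {c : Certificate B} {X : N → D}
    (h : Induces B c X) : IsConsistent B c where
  subgraph := by
    rintro _ _ (a | d)
    · exact .entry a (c a)
    · exact .alt d
  root_sink := by rintro _ ⟨⟩
  existsUnique_out := by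
    rintro (a | d | _) hu
    · exact ⟨_, .chosen a, by rintro _ ⟨⟩; rfl⟩
    · exact ⟨_, .alt d, by rintro _ ⟨⟩; rfl⟩
    · exact absurd rfl hu
  reaches_root := by
    rintro (a | d | _)
    · exact (h a).tail (.alt _)
    · exact .single (.alt d)
    · exact .refl

theorem exists_isConsistent (B : BallotList N D) : ∃ c, IsConsistent B c :=
  -- Nobody delegates: every agent uses the backup vote.
  ⟨fun a => Fin.last _, Induces.isConsistent (X := fun a => (B a).backup) <|
    induces_iff_votes.2 fun a => .direct (by simp [successor, Ballot.entry, Ballot.size])⟩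

theorem minSum_nonempty [Fintype N] (B : BallotList N D) : (minSum B).Nonempty := by
  classical
  obtain ⟨c, hc, hmin⟩ := Set.exists_min_image {c | IsConsistent B c}
    (fun c => ∑ a, (c a : ℕ)) (Set.toFinite _) (exists_isConsistent B)
  obtain ⟨X, hX⟩ := IsConsistent.exists_induces hc
  exact ⟨X, c, ⟨hc, hmin⟩, hX⟩

/-! ### The exchange argument -/

/-- If `f` coincides with `f₂` on the agents that vote for `d` under `f₂` and with `f₁` on the
others, then every agent votes for `d` or as under `f₁`. -/
theorem exists_votes_of_eqOn_join {f f₁ f₂ : N → Vertex N D} {X₁ X₂ : N → D} {d : D}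
    (h₁ : ∀ a, Votes f₁ (X₁ a) a) (h₂ : ∀ a, Votes f₂ (X₂ a) a)
    (hf₂ : ∀ a, X₂ a = d → f a = f₂ a) (hf₁ : ∀ a, X₂ a ≠ d → f a = f₁ a) :
    ∃ X : N → D, (∀ a, Votes f (X a) a) ∧ ∀ a, X₁ a = d ∨ X₂ a = d → X a = d := by
  -- The `f₂`-path of a `d`-voter passes through `d`-voters only, where `f` follows `f₂`.
  have hd : ∀ a, Votes f₂ d a → Votes f d a := by
    intro a ha
    induction ha with
    | direct h => exact .direct ((hf₂ _ ((h₂ _).unique (.direct h))).trans h)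
    | delegate h hb ih => exact .delegate ((hf₂ _ ((h₂ _).unique (.delegate h hb))).trans h) ih
  have hd' : ∀ a, X₂ a = d → Votes f d a := fun a ha => hd a (ha ▸ h₂ a)
  -- The `f₁`-path either meets a `d`-voter of `f₂`, and is then diverted to `d`, or is followed to
  -- its end.
  have H : ∀ e a, Votes f₁ e a → Votes f d a ∨ Votes f e a := by
    intro e a ha
    induction ha with
    | @direct a h =>
      by_cases hX : X₂ a = d
      · exact .inl (hd' a hX)
      · exact .inr (.direct ((hf₁ a hX).trans h))
    | @delegate a b h _ ih =>
      by_cases hX : X₂ a = d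
      · exact .inl (hd' a hX)
      · exact ih.imp (.delegate ((hf₁ a hX).trans h)) (.delegate ((hf₁ a hX).trans h))
  have H' : ∀ a, ∃ e, Votes f e a ∧ (X₁ a = d ∨ X₂ a = d → e = d) := by
    intro a
    rcases H _ a (h₁ a) with h | h
    · exact ⟨d, h, fun _ => rfl⟩
    · refine ⟨X₁ a, h, ?_⟩
      rintro (h' | h')
      · exact h'
      · exact h.unique (hd' a h')
  choose X hX using H'
  exact ⟨X, fun a => (hX a).1, fun a => (hX a).2⟩

/-- If `f` coincides with `f₁` on the agents that vote for `d` under `f₂` and with `f₂` on the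
others, then only agents that vote for `d` under both `f₁` and `f₂` can vote for `d`. -/
theorem exists_votes_of_eqOn_meet {f f₁ f₂ : N → Vertex N D} {X₁ X₂ : N → D} {d : D}
    (h₁ : ∀ a, Votes f₁ (X₁ a) a) (h₂ : ∀ a, Votes f₂ (X₂ a) a)
    (hf₁ : ∀ a, X₂ a = d → f a = f₁ a) (hf₂ : ∀ a, X₂ a ≠ d → f a = f₂ a) :
    ∃ X : N → D, (∀ a, Votes f (X a) a) ∧ ∀ a, X a = d → X₁ a = d ∧ X₂ a = d := by
  have hne : ∀ e a, e ≠ d → Votes f₂ e a → Votes f e a := by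
    intro e a he ha
    induction ha with
    | direct h => exact .direct ((hf₂ _ ((h₂ _).unique (.direct h) ▸ he)).trans h)
    | delegate h hb ih =>
      exact .delegate ((hf₂ _ ((h₂ _).unique (.delegate h hb) ▸ he)).trans h) ih
  -- Here `f` follows `f₁` while inside the set of `d`-voters of `f₂`; once outside, it follows `f₂`
  -- to an alternative other than `d`.
  have H : ∀ e a, Votes f₁ e a → (∃ e', e' ≠ d ∧ Votes f e' a) ∨ (Votes f e a ∧ X₂ a = d) := by
    intro e a ha
    induction ha with
    | @direct a h =>
      by_cases hX : X₂ a = d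
      · exact .inr ⟨.direct ((hf₁ a hX).trans h), hX⟩
      · exact .inl ⟨_, hX, hne _ a hX (h₂ a)⟩
    | @delegate a b h _ ih =>
      by_cases hX : X₂ a = d
      · rcases ih with ⟨e', he', hb⟩ | ⟨hb, _⟩
        · exact .inl ⟨e', he', .delegate ((hf₁ a hX).trans h) hb⟩
        · exact .inr ⟨.delegate ((hf₁ a hX).trans h) hb, hX⟩
      · exact .inl ⟨_, hX, hne _ a hX (h₂ a)⟩
  have H' : ∀ a, ∃ e, Votes f e a ∧ (e = d → X₁ a = d ∧ X₂ a = d) := by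
    intro a
    rcases H _ a (h₁ a) with ⟨e, he, h⟩ | ⟨h, h'⟩
    · exact ⟨e, h, fun h' => absurd h' he⟩
    · exact ⟨X₁ a, h, fun h'' => ⟨h'', h'⟩⟩
  choose X hX using H'
  exact ⟨X, fun a => (hX a).1, fun a => (hX a).2⟩

/-- Exchange property: if the ballot lists `B` and `B'` differ only at agents that vote for `d`
in `X' ∈ minSum B'`, then swapping the choices of the voters for `d` in `X'` keeps optimality. -/
theorem minSum_exchange [Fintype N] {B B' : BallotList N D} {X X' : N → D} {d : D}
    (hX : X ∈ minSum B) (hX' : X' ∈ minSum B') (hB : ∀ a, X' a ≠ d → B a = B' a) :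
    (∃ Y ∈ minSum B', ∀ a, X a = d ∨ X' a = d → Y a = d) ∧
      ∃ Y ∈ minSum B, ∀ a, Y a = d → X a = d ∧ X' a = d := by
  classical
  obtain ⟨c, ⟨hc, hmin⟩, hcX⟩ := hX
  obtain ⟨c', ⟨hc', hmin'⟩, hcX'⟩ := hX'
  -- Positions may cross between the lists exactly where `X' a ≠ d`, since the ballots agree there.
  let j : Certificate B' := fun a =>
    if h : X' a = d then c' a else ⟨c a, by rw [← hB a h]; exact (c a).2⟩
  let m : Certificate B := fun a =>
    if h : X' a = d then c a else ⟨c' a, by rw [hB a h]; exact (c' a).2⟩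
  rw [induces_iff_votes] at hcX hcX'
  obtain ⟨Y, hY, hYd⟩ := exists_votes_of_eqOn_join (f := successor B' j) (d := d) hcX hcX'
    (fun a h => by simp [successor, j, h])
    (fun a h => (Ballot.entry_congr (hB a h) (by simp [j, h])).symm)
  obtain ⟨Z, hZ, hZd⟩ := exists_votes_of_eqOn_meet (f := successor B m) (d := d) hcX hcX'
    (fun a h => by simp [successor, m, h])
    (fun a h => Ballot.entry_congr (hB a h) (by simp [m, h]))
  rw [← induces_iff_votes] at hY hZ
  -- The swap preserves the total cost and neither new certificate can beat its optimum, so both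
  -- attain it.
  have hsum : ∑ a, (j a : ℕ) + ∑ a, (m a : ℕ) = ∑ a, (c' a : ℕ) + ∑ a, (c a : ℕ) := by
    rw [← Finset.sum_add_distrib, ← Finset.sum_add_distrib]
    refine Finset.sum_congr rfl fun a _ => ?_
    by_cases h : X' a = d
    · simp [j, m, h]
    · simp [j, m, h, add_comm]
  have hj := hmin' j hY.isConsistent
  have hm := hmin m hZ.isConsistent
  refine ⟨⟨Y, ⟨j, ⟨hY.isConsistent, fun c₀ h₀ => ?_⟩, hY⟩, hYd⟩,
    ⟨Z, ⟨m, ⟨hZ.isConsistent, fun c₀ h₀ => ?_⟩, hZ⟩, hZd⟩⟩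
  · have := hmin' c₀ h₀
    omega
  · have := hmin c₀ h₀
    omega

/-! ### Resoluteness of the biased rules -/

/-- An output of the biased procedure contains all votes for `p` of all outputs of `minSum`. -/
theorem eq_of_mem_minSumBiased [Fintype N] [DecidableEq D] {B : BallotList N D} {p : D}
    {X Y : N → D} (hX : X ∈ minSumBiased p B) (hY : Y ∈ minSum B) {a : N} (ha : Y a = p) :
    X a = p := by
  obtain ⟨Z, hZ, hZp⟩ := (minSum_exchange (d := p) hX.1 hY fun _ _ => rfl).1
  have hsub : (Finset.univ.filter fun a => X a = p) ⊆ Finset.univ.filter fun a => Z a = p :=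
    fun b hb => by simpa using hZp b (.inl (by simpa using hb))
  -- The join `Z` of `X` and `Y` cannot have more `p`-voters than `X`, so it has the same ones.
  have heq := Finset.eq_of_subset_of_card_le hsub (hX.2 Z hZ)
  have hmem : a ∈ Finset.univ.filter fun a => Z a = p := by simpa using hZp a (.inr ha)
  rw [← heq] at hmem
  simpa using hmem

theorem minSumBiased_nonempty [Fintype N] [DecidableEq D] [Finite D] (p : D)
    (B : BallotList N D) : (minSumBiased p B).Nonempty := by
  obtain ⟨X, hX, hmax⟩ := Set.exists_max_image (minSum B)
    (fun X => (Finset.univ.filter fun a => X a = p).card) (Set.toFinite _) (minSum_nonempty B)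
  exact ⟨X, hX, hmax⟩

/-- Two outputs contain each other's `p`-voters, and with only two alternatives these determine all
votes. -/
theorem isResolute_minSumBiased [Fintype N] (p : Bool) :
    IsResolute (minSumBiased p : UnravellingProcedure N Bool) := by
  intro B
  obtain ⟨X, hX⟩ := minSumBiased_nonempty p B
  refine ⟨X, hX, fun Y hY => funext fun a => ?_⟩
  have h₁ : X a = p → Y a = p := eq_of_mem_minSumBiased hY hX.1
  have h₂ : Y a = p → X a = p := eq_of_mem_minSumBiased hX hY.1
  revert h₁ h₂
  cases X a <;> cases Y a <;> cases p <;> simp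

/-! ### Cast monotonicity -/

theorem Monotone.map_eq_of_forall_imp {agg : (N → Bool) → Bool} (hagg : Monotone agg)
    {X Y : N → Bool} {d : Bool} (h : ∀ a, X a = d → Y a = d) (hX : agg X = d) : agg Y = d := by
  cases d with
  | true =>
    have := hagg (show X ≤ Y from fun a => by
      have := h a
      revert this
      cases X a <;> cases Y a <;> simp)
    rw [hX] at this
    exact top_le_iff.1 this
  | false =>
    have := hagg (show Y ≤ X from fun a => by
      have := h a
      revert this
      cases X a <;> cases Y a <;> simp)
    rw [hX] at this
    exact le_bot_iff.1 this

/-- A procedure is cast-monotonic if a vote cast for `d` shifts its outputs towards `d`. -/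
theorem castMonotonic_of_forall_exists [DecidableEq N] {F : UnravellingProcedure N Bool}
    (hup : ∀ (B : BallotList N Bool) (a : N) (d : Bool), ∀ X ∈ F B,
      ∃ Y ∈ F (Function.update B a (Ballot.direct a d)), ∀ b, X b = d → Y b = d)
    (hdown : ∀ (B : BallotList N Bool) (a : N) (d : Bool),
      ∀ Y ∈ F (Function.update B a (Ballot.direct a d)), ∃ X ∈ F B, ∀ b, X b = d → Y b = d) :
    CastMonotonic F := by
  intro agg hagg B a d
  constructor
  · rintro ⟨X, hX, hXd⟩
    obtain ⟨Y, hY, hXY⟩ := hup B a d X hX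
    exact ⟨Y, hY, Monotone.map_eq_of_forall_imp hagg hXY hXd⟩
  · rintro h ⟨Y, hY, hYd⟩
    obtain ⟨X, hX, hXY⟩ := hdown B a d Y hY
    -- By contraposition, every vote for `!d` in `Y` is one in `X`.
    refine h ⟨X, hX, Monotone.map_eq_of_forall_imp hagg (fun b hb => ?_) hYd⟩
    have := hXY b
    revert this hb
    cases X b <;> cases Y b <;> cases d <;> simp

theorem eq_of_mem_minSum_update_direct [Fintype N] [DecidableEq N] {B : BallotList N D} {a : N}
    {d : D} {X : N → D} (hX : X ∈ minSum (Function.update B a (Ballot.direct a d))) :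
    X a = d := by
  obtain ⟨c, -, hc⟩ := hX
  refine (induces_iff_votes.1 hc a).unique (.direct ?_)
  rw [successor, Ballot.entry_congr (b' := Ballot.direct a d) (j := 0) (Function.update_self ..)]
  · rfl
  · have h := (c a).2
    have hs : (Function.update B a (Ballot.direct a d) a).size = 0 := by
      rw [Function.update_self]
      rfl
    simp only [Fin.val_zero]
    omega

/-- The exchange applies because the one agent whose ballot changed votes for `d` in `Y`. -/
theorem minSum_update_direct_exchange [Fintype N] [DecidableEq N] {B : BallotList N D} {a : N}
    {d : D} {X Y : N → D} (hX : X ∈ minSum B)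
    (hY : Y ∈ minSum (Function.update B a (Ballot.direct a d))) :
    (∃ Z ∈ minSum (Function.update B a (Ballot.direct a d)), ∀ b, X b = d → Z b = d) ∧
      ∃ Z ∈ minSum B, ∀ b, Z b = d → Y b = d := by
  obtain ⟨⟨Z, hZ, hZd⟩, Z', hZ', hZd'⟩ := minSum_exchange (d := d) hX hY fun b hb => by
    rw [Function.update_of_ne]
    rintro rfl
    exact hb (eq_of_mem_minSum_update_direct hY)
  exact ⟨⟨Z, hZ, fun b hb => hZd b (.inl hb)⟩, Z', hZ', fun b hb => (hZd' b hb).2⟩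

theorem castMonotonic_minSum [Fintype N] [DecidableEq N] :
    CastMonotonic (minSum : UnravellingProcedure N Bool) := by
  refine castMonotonic_of_forall_exists (fun B a d X hX => ?_) (fun B a d Y hY => ?_)
  · obtain ⟨Y, hY⟩ := minSum_nonempty (Function.update B a (Ballot.direct a d))
    exact (minSum_update_direct_exchange hX hY).1
  · obtain ⟨X, hX⟩ := minSum_nonempty B
    exact (minSum_update_direct_exchange hX hY).2

theorem castMonotonic_minSumBiased [Fintype N] [DecidableEq N] (p : Bool) :
    CastMonotonic (minSumBiased p : UnravellingProcedure N Bool) := by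
  have key : ∀ (B : BallotList N Bool) (a : N) (d : Bool), ∀ X ∈ minSumBiased p B,
      ∀ Y ∈ minSumBiased p (Function.update B a (Ballot.direct a d)),
        ∀ b, X b = d → Y b = d := by
    intro B a d X hX Y hY b hb
    obtain ⟨⟨Z, hZ, hXZ⟩, Z', hZ', hZY⟩ := minSum_update_direct_exchange hX.1 hY.1
    -- If `p = d`, then `Y` contains the `d`-voters of the join `Z`, hence those of `X`. Otherwise
    -- `X` has the fewest `d`-voters in `minSum B`, so they lie among those of the meet `Z'`, hence
    -- of `Y`.
    by_cases hp : p = d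
    · subst hp
      exact eq_of_mem_minSumBiased hY hZ (hXZ b hb)
    · refine hZY b ?_
      by_contra hne
      have hZp : Z' b = p := by
        revert hne hp
        cases Z' b <;> cases d <;> cases p <;> simp
      exact hp ((eq_of_mem_minSumBiased hX hZ' hZp).symm.trans hb)
  refine castMonotonic_of_forall_exists (fun B a d X hX => ?_) (fun B a d Y hY => ?_)
  · obtain ⟨Y, hY⟩ := minSumBiased_nonempty p (Function.update B a (Ballot.direct a d))
    exact ⟨Y, hY, key B a d X hX Y hY⟩
  · obtain ⟨X, hX⟩ := minSumBiased_nonempty p B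
    exact ⟨X, hX, key B a d X hX Y hY⟩

end LiquidDemocracy

theorem mainTheorem8 {N : Type*} [Fintype N] [DecidableEq N] :
    LiquidDemocracy.CastMonotonic
      (LiquidDemocracy.minSum : LiquidDemocracy.UnravellingProcedure N Bool) ∧
    (LiquidDemocracy.IsResolute
        (LiquidDemocracy.minSumBiased false : LiquidDemocracy.UnravellingProcedure N Bool) ∧
      LiquidDemocracy.CastMonotonic
        (LiquidDemocracy.minSumBiased false : LiquidDemocracy.UnravellingProcedure N Bool)) ∧
    (LiquidDemocracy.IsResolute
        (LiquidDemocracy.minSumBiased true : LiquidDemocracy.UnravellingProcedure N Bool) ∧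
      LiquidDemocracy.CastMonotonic
        (LiquidDemocracy.minSumBiased true : LiquidDemocracy.UnravellingProcedure N Bool)) := by
  open LiquidDemocracy in
  exact ⟨castMonotonic_minSum, ⟨isResolute_minSumBiased false, castMonotonic_minSumBiased false⟩,
    isResolute_minSumBiased true, castMonotonic_minSumBiased true⟩
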